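/- Let $n\ge 1$, and order $\mathbb Z^n$ coordinatewise: $\alpha\le\beta$ iff $\alpha_i\le\beta_i$ for all $i$. Let $\Lambda\subset\mathbb Z^n$ be an antichain lattice, i.e. a subgroup whose elements are pairwise incomparable. Let $A\subset\mathbb Z^n$ be $\Lambda$-finite: $A=A+\Lambda$, and there is a finite set $A_0\subseteq A$ with $A=A_0+\Lambda$ and $a-b\notin\Lambda$ for distinct $a,b\in A_0$. Assume that $A$ is generic: for every $\eta\in\mathbb Z^n$ such that no $\alpha\in A$ satisfies $\alpha_i<\eta_i$ for all $i$, and for every nonempty $X\subseteq\{1,\dots,n\}$, there is at most one $\alpha\in A$ with $\alpha\le\eta$ and $\alpha_i=\eta_i$ for all $i\in X$. The Scarf complex $N(A)$ is the set of strongly neighborly sets of $A$, i.e. of the finite sets $\sigma\subseteq A$ such that $\sigma$ is the only subset of $A$ whose coordinatewise supremum equals $\bigvee\sigma$ (the empty set is included). For real $t>1$ and $\alpha\in\mathbb Z^n$ let $E_t(\alpha)=(t^{\alpha_1},\dots,t^{\alpha_n})$, let $E_t(F)=\{E_t(\alpha)\mid\alpha\in F\}$ for $F\subseteq A$, and let $\mathcal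 P_t(A)=\operatorname{conv}(E_t(A))+\mathbb R^n_{\ge0}$. Let $\operatorname{hull}_t(A)$ be the set of all $E_t(F)$, $F\subseteq A$, such that $\operatorname{conv}(E_t(F))$ is a face of $\mathcal P_t(A)$; here a face is the (possibly empty) intersection of $\mathcal P_t(A)$ with a hyperplane such that $\mathcal P_t(A)$ lies in one of the two closed half-spaces that this hyperplane bounds. Then for all sufficiently large $t$ the Scarf complex is isomorphic to the hull complex, $N(A)\cong\operatorname{hull}(A)$. More precisely, there is $T>1$ such that for every $t\ge T$ the map $\alpha\mapsto E_t(\alpha)$ is an isomorphism of complexes from $N(A)$ to $\operatorname{hull}_t(A)$: it is a bijection between the vertices of $N(A)$ and those of $\operatorname{hull}_t(A)$, and a set $\sigma$ of vertices of $N(A)$ is a face of $N(A)$ if and only if $E_t(\sigma)\in\operatorname{hull}_t(A)$. Moreover, the points of $E_t(\sigma)$ are affinely independent for each $\sigma\in N(A)$, so that the cells $\operatorname{conv}(E_t(\sigma))$ of the hull complex are simplices. -/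

import Mathlib

open scoped Pointwise

namespace ScarfHull

variable {n : ℕ}

/-- The open orthant `T°_η = η - ℕ_{>0}^n`: all integer points strictly below `η` in every
coordinate. -/
def openOrthant (η : Fin n → ℤ) : Set (Fin n → ℤ) := {α | ∀ i, α i < η i}

/-- The `X`-face of the closed orthant `T_η = η - ℕ^n`: the points of `T_η` that agree with `η`
in every coordinate `i ∈ X`. -/
def orthantFace (η : Fin n → ℤ) (X : Set (Fin n)) : Set (Fin n → ℤ) :=
  {α | α ≤ η ∧ ∀ i ∈ X, α i = η i}

/-- `A ⊆ ℤ^n` is generic if, whenever `T°_η` contains no point of `A`, every `X`-face of `T_η`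
(`X` nonempty) contains at most one point of `A`. -/
def IsGeneric (A : Set (Fin n → ℤ)) : Prop :=
  ∀ η : Fin n → ℤ, openOrthant η ∩ A = ∅ →
    ∀ X : Set (Fin n), X.Nonempty → (orthantFace η X ∩ A).Subsingleton

/-- `A₀` is a set of `Λ`-representatives for `A`. -/
structure IsRepresentatives (Λ : AddSubgroup (Fin n → ℤ)) (A A₀ : Set (Fin n → ℤ)) : Prop where
  subset : A₀ ⊆ A
  eq_add : A = A₀ + (Λ : Set (Fin n → ℤ))
  sub_notMem : ∀ a ∈ A₀, ∀ b ∈ A₀, a ≠ b → a - b ∉ Λ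

/-- `A` is a `Λ`-set (`A = A + Λ`) with a finite set of `Λ`-representatives. -/
def IsLambdaFinite (Λ : AddSubgroup (Fin n → ℤ)) (A : Set (Fin n → ℤ)) : Prop :=
  A = A + (Λ : Set (Fin n → ℤ)) ∧ ∃ A₀ : Set (Fin n → ℤ), A₀.Finite ∧ IsRepresentatives Λ A A₀

/-- A finite subset `B` of `A` is strongly neighborly if it is the only subset of `A` whose
supremum is `⋁ B`.  The supremum is the least upper bound in `ℤ^n`, that is, the coordinatewise
maximum.  The empty set (whose supremum is `-∞`, which no nonempty set has) counts as strongly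
neighborly: for `n ≥ 1` it has no least upper bound in `ℤ^n`. -/
def IsStronglyNeighborly (A B : Set (Fin n → ℤ)) : Prop :=
  B ⊆ A ∧ B.Finite ∧
    ∀ B' : Set (Fin n → ℤ), B' ⊆ A → ∀ s : Fin n → ℤ, IsLUB B s → IsLUB B' s → B' = B

/-- The Scarf complex `N(A)`. -/
def scarfComplex (A : Set (Fin n → ℤ)) : Set (Set (Fin n → ℤ)) :=
  {σ | IsStronglyNeighborly A σ}

/-- `E_t(α) = (t^{α_1}, …, t^{α_n})`. -/
noncomputable def expPoint (t : ℝ) (α : Fin n → ℤ) : Fin n → ℝ := fun i => t ^ (α i)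

/-- `P_t(A) = conv(E_t(A)) + ℝ_{≥0}^n`. -/
def hullPolyhedron (t : ℝ) (A : Set (Fin n → ℤ)) : Set (Fin n → ℝ) :=
  convexHull ℝ (expPoint t '' A) + {x : Fin n → ℝ | 0 ≤ x}

/-- `G` is a (proper, possibly empty) face of the convex set `P`: the intersection of `P` with a
hyperplane `{x | ⟨c, x⟩ = m}`, `c ≠ 0`, such that `P` lies in the half-space `{x | m ≤ ⟨c, x⟩}`. -/
def IsFaceOf (P G : Set (Fin n → ℝ)) : Prop :=
  ∃ (c : Fin n → ℝ) (m : ℝ), c ≠ 0 ∧ (∀ x ∈ P, m ≤ ∑ i, c i * x i) ∧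
    G = {x | x ∈ P ∧ ∑ i, c i * x i = m}

/-- `hull_t(A)`: the sets of points `E_t(F)`, with `F` any (finite or infinite) subset of `A`, for
which `conv(E_t(F))` is a face of `P_t(A)`. -/
def hullComplex (t : ℝ) (A : Set (Fin n → ℤ)) : Set (Set (Fin n → ℝ)) :=
  {G | ∃ F : Set (Fin n → ℤ), F ⊆ A ∧ G = expPoint t '' F ∧
    IsFaceOf (hullPolyhedron t A) (convexHull ℝ G)}

/-- The map `f` on vertices is an isomorphism from the complex `K` to the complex `L`, both given
by the vertex sets of their faces: it is a bijection between the vertices of `K` and those of `L`,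
and a set of vertices of `K` is a face of `K` exactly when its image is a face of `L`. -/
def IsComplexIso {V W : Type*} (K : Set (Set V)) (L : Set (Set W)) (f : V → W) : Prop :=
  Set.BijOn f (⋃₀ K) (⋃₀ L) ∧ ∀ σ : Set V, σ ⊆ ⋃₀ K → (σ ∈ K ↔ f '' σ ∈ L)

end ScarfHull

/-!
Write `ℓ(x) = ∑ i, c i * x i`. For `t > 4 n` the condition that `ℓ` supports the hull polyhedron
along the points `E_t(α)`, `α ∈ σ`, is a combinatorial condition on `σ`, because one step in one
coordinate outweighs the sum over all `n` coordinates. The bound on `t` depends on `n` only.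

A nonempty finite `B ⊆ A` with supremum `s` is strongly neighborly if and only if no point of `A`
lies strictly below `s` (`IsStronglyNeighborly.openOrthant_inter_eq_empty`,
`IsGeneric.isStronglyNeighborly`); then every coordinate of `s` is attained by exactly one point
of `B`, and `B` is the set of all points of `A` below `s`.

*Scarf faces are hull faces.* Let `p j` be the point of `σ` that attains the coordinate `s j`. For
`α ∈ σ` the number `t ^ (α j - s j)` is `1` if `p j = α` and at most `1 / t` otherwise. A linear
system with a diagonally dominant matrix (`exists_add_mulVec_eq_one`) therefore gives positive
weights `c j`, comparable to `t ^ (-s j)` divided by the number of coordinates that `p j` attains, with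
`ℓ(E_t(α)) = 1` on `σ`. A point of `A` outside `σ` exceeds `s` in some coordinate, and this alone
makes `ℓ` larger than `1` (`exists_supporting_functional`). The same diagonal dominance gives the
affine independence (`affineIndependent_expPoint`).

*Hull faces are Scarf faces.* Let `ℓ ≥ m` cut out a nonempty face `conv(E_t(F))`. Then `c ≥ 0` and
`m > 0`. For `c i > 0` let `h i` be the maximum of `α i` over `α ∈ F`, so that
`c i * t ^ h i ≤ m`. A point `γ ∈ A` with `γ i < h i` whenever `c i > 0` would have
`ℓ(E_t(γ)) ≤ n m / t < m`. So there is none (`exists_le_of_le_functional`), and genericity shows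
that points of `F` are determined by a coordinate `i` with `c i > 0` in which they attain `h i`.
Hence `F` is finite, its face is bounded, all `c i` are positive, and `h` is the supremum of `F`.
-/

open scoped Matrix

namespace ScarfHull

/-! ### Strongly neighborly sets -/

/-- A least upper bound in `ℤ^n` is an upper bound each of whose coordinates is attained. -/
lemma isLUB_iff_attained {B : Set (Fin n → ℤ)} {s : Fin n → ℤ} :
    IsLUB B s ↔ (∀ α ∈ B, α ≤ s) ∧ ∀ i, ∃ α ∈ B, α i = s i := by
  refine ⟨fun h => ⟨fun α hα => h.1 hα, fun i => ?_⟩, fun h => ⟨fun α hα => h.1 α hα, ?_⟩⟩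
  · by_contra! hne
    have hub : Function.update s i (s i - 1) ∈ upperBounds B := by
      intro α hα j
      rcases eq_or_ne j i with rfl | hj
      · have h1 := h.1 hα j
        have h2 := hne α hα
        simp only [Function.update_self]
        lia
      · simpa [hj] using h.1 hα j
    have h3 := h.2 hub i
    simp at h3
  · intro u hu i
    obtain ⟨α, hα, hi⟩ := h.2 i
    exact hi ▸ hu hα i

lemma exists_isLUB {B : Set (Fin n → ℤ)} (hB : B.Finite) (hne : B.Nonempty) :
    ∃ s, IsLUB B s := by
  have h : ∀ i, ∃ α ∈ B, ∀ β ∈ B, β i ≤ α i := fun i =>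
    Set.exists_max_image B (fun α => α i) hB hne
  choose f hf hmax using h
  exact ⟨fun i => f i i, isLUB_iff_attained.2
    ⟨fun α hα i => hmax i α hα, fun i => ⟨f i, hf i, rfl⟩⟩⟩

lemma isStronglyNeighborly_empty (hn : 1 ≤ n) (A : Set (Fin n → ℤ)) :
    IsStronglyNeighborly A ∅ := by
  refine ⟨Set.empty_subset _, Set.finite_empty, fun B' _ s hs _ => ?_⟩
  obtain ⟨α, hα, -⟩ := (isLUB_iff_attained.1 hs).2 ⟨0, hn⟩
  exact hα.elim

lemma IsStronglyNeighborly.mem_of_le {A B : Set (Fin n → ℤ)} (hB : IsStronglyNeighborly A B)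
    {s : Fin n → ℤ} (hs : IsLUB B s) {β : Fin n → ℤ} (hβ : β ∈ A) (hle : β ≤ s) : β ∈ B := by
  have h : insert β B = B := by
    refine hB.2.2 _ (Set.insert_subset hβ hB.1) s hs (isLUB_iff_attained.2 ⟨?_, fun i => ?_⟩)
    · rintro α (rfl | hα)
      · exact hle
      · exact hs.1 hα
    · obtain ⟨α, hα, hi⟩ := (isLUB_iff_attained.1 hs).2 i
      exact ⟨α, Set.mem_insert_of_mem _ hα, hi⟩
  exact h ▸ Set.mem_insert β B

lemma IsStronglyNeighborly.openOrthant_inter_eq_empty {A B : Set (Fin n → ℤ)}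
    (hB : IsStronglyNeighborly A B) {s : Fin n → ℤ} (hs : IsLUB B s) :
    openOrthant s ∩ A = ∅ := by
  refine Set.eq_empty_iff_forall_notMem.2 fun γ ⟨hlt, hγ⟩ => ?_
  have hγB : γ ∈ B := hB.mem_of_le hs hγ fun i => (hlt i).le
  -- Removing a point strictly below the supremum does not change the supremum.
  have h : B \ {γ} = B := by
    refine hB.2.2 _ (Set.sdiff_subset.trans hB.1) s hs (isLUB_iff_attained.2 ⟨?_, fun i => ?_⟩)
    · exact fun α hα => hs.1 hα.1
    · obtain ⟨α, hα, hi⟩ := (isLUB_iff_attained.1 hs).2 i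
      refine ⟨α, ⟨hα, ?_⟩, hi⟩
      rintro rfl
      exact (hlt i).ne hi
  rw [← h] at hγB
  exact hγB.2 rfl

lemma IsGeneric.eq_of_coord_eq {A : Set (Fin n → ℤ)} (hgen : IsGeneric A) {s : Fin n → ℤ}
    (hs : openOrthant s ∩ A = ∅) {α β : Fin n → ℤ} (hα : α ∈ A) (hβ : β ∈ A)
    (hαs : α ≤ s) (hβs : β ≤ s) {i : Fin n} (hαi : α i = s i) (hβi : β i = s i) : α = β :=
  hgen s hs {i} (Set.singleton_nonempty i) ⟨⟨hαs, by simpa using hαi⟩, hα⟩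
    ⟨⟨hβs, by simpa using hβi⟩, hβ⟩

lemma exists_coord_eq {A : Set (Fin n → ℤ)} {s : Fin n → ℤ} (hs : openOrthant s ∩ A = ∅)
    {α : Fin n → ℤ} (hα : α ∈ A) (hle : α ≤ s) : ∃ i, α i = s i := by
  by_contra! hne
  exact Set.eq_empty_iff_forall_notMem.1 hs α ⟨fun i => lt_of_le_of_ne (hle i) (hne i), hα⟩

lemma IsGeneric.isStronglyNeighborly {A B : Set (Fin n → ℤ)} (hgen : IsGeneric A) (hBA : B ⊆ A)
    (hfin : B.Finite) {s : Fin n → ℤ} (hs : IsLUB B s) (hempty : openOrthant s ∩ A = ∅) :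
    IsStronglyNeighborly A B := by
  -- A point of one set shares an extremal coordinate with a point of the other set.
  have key : ∀ C D : Set (Fin n → ℤ), C ⊆ A → D ⊆ A → IsLUB C s → IsLUB D s → C ⊆ D := by
    intro C D hC hD hCs hDs α hα
    obtain ⟨i, hi⟩ := exists_coord_eq hempty (hC hα) (hCs.1 hα)
    obtain ⟨β, hβ, hβi⟩ := (isLUB_iff_attained.1 hDs).2 i
    rwa [hgen.eq_of_coord_eq hempty (hC hα) (hD hβ) (hCs.1 hα) (hDs.1 hβ) hi hβi]
  refine ⟨hBA, hfin, fun B' hB' s' hs' hBs' => ?_⟩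
  obtain rfl := hs.unique hs'
  exact (key _ _ hB' hBA hBs' hs).antisymm (key _ _ hBA hB' hs hBs')

/-! ### The exponential map and linear functionals -/

lemma expPoint_pos {t : ℝ} (ht : 0 < t) (α : Fin n → ℤ) (i : Fin n) : 0 < expPoint t α i :=
  zpow_pos ht _

lemma expPoint_injective {t : ℝ} (ht : 1 < t) :
    Function.Injective (expPoint t : (Fin n → ℤ) → Fin n → ℝ) := fun _ _ h =>
  funext fun i => zpow_right_injective₀ (zero_lt_one.trans ht) ht.ne' (congrFun h i)

lemma zpow_sub_le_inv {t : ℝ} (ht : 1 < t) {a b : ℤ} (h : a < b) : t ^ (a - b) ≤ t⁻¹ := by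
  rw [← zpow_neg_one]
  exact zpow_le_zpow_right₀ ht.le (by lia)

lemma dotProduct_add_single {x : Fin n → ℝ} (c : Fin n → ℝ) (i : Fin n) (r : ℝ) :
    c ⬝ᵥ (x + Pi.single i r) = c ⬝ᵥ x + c i * r := by
  rw [dotProduct_add, dotProduct_single]

lemma expPoint_add_mem_hullPolyhedron {t : ℝ} {A : Set (Fin n → ℤ)} {α : Fin n → ℤ} (hα : α ∈ A)
    {y : Fin n → ℝ} (hy : 0 ≤ y) : expPoint t α + y ∈ hullPolyhedron t A :=
  Set.add_mem_add (subset_convexHull ℝ _ ⟨α, hα, rfl⟩) hy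

/-- If a linear functional equals `m` on `S` and exceeds `m` on the other points of `V`, then
the points of `conv V` at which it equals `m` lie in `conv S`. -/
lemma mem_convexHull_or_lt {S V : Set (Fin n → ℝ)} {c : Fin n → ℝ} {m : ℝ}
    (hS : ∀ x ∈ S, c ⬝ᵥ x = m) (hV : ∀ x ∈ V, x ∉ S → m < c ⬝ᵥ x) {x : Fin n → ℝ}
    (hx : x ∈ convexHull ℝ V) : (x ∈ convexHull ℝ S ∧ c ⬝ᵥ x = m) ∨ m < c ⬝ᵥ x := by
  have hsub : V ⊆ {x | (x ∈ convexHull ℝ S ∧ c ⬝ᵥ x = m) ∨ m < c ⬝ᵥ x} := by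
    intro y hy
    by_cases hyS : y ∈ S
    · exact Or.inl ⟨subset_convexHull ℝ S hyS, hS y hyS⟩
    · exact Or.inr (hV y hy hyS)
  refine convexHull_min hsub (convex_iff_forall_pos.2 ?_) hx
  intro y hy z hz a b ha hb hab
  have hval : c ⬝ᵥ (a • y + b • z) = a * (c ⬝ᵥ y) + b * (c ⬝ᵥ z) := by
    simp [dotProduct_add, dotProduct_smul]
  have hm : m = a * m + b * m := by rw [← add_mul, hab, one_mul]
  simp only [Set.mem_ofPred_eq, hval]
  rcases hy with ⟨hy, hy'⟩ | hy <;> rcases hz with ⟨hz, hz'⟩ | hz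
  · exact Or.inl ⟨convex_convexHull ℝ S hy hz ha.le hb.le hab, by rw [hy', hz', ← hm]⟩
  · right
    nlinarith [mul_lt_mul_of_pos_left hz hb]
  · right
    nlinarith [mul_lt_mul_of_pos_left hy ha]
  · right
    nlinarith [mul_lt_mul_of_pos_left hy ha, mul_lt_mul_of_pos_left hz hb]

/-! ### Diagonally dominant systems -/

/-- A small nonnegative perturbation `1 + K` of the identity sends a positive vector to the vector
of ones. -/
lemma exists_add_mulVec_eq_one {K : Matrix (Fin n) (Fin n) ℝ} {ε : ℝ} (hK0 : ∀ i j, 0 ≤ K i j)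
    (hKε : ∀ i j, K i j ≤ ε) (hε : n * ε ≤ 1 / 4) (hdiag : ∀ i, K i i = 0) :
    ∃ v : Fin n → ℝ, (∀ i, v i + ∑ j, K i j * v j = 1) ∧ ∀ i, 1 / 2 ≤ v i := by
  have hrow : ∀ i, ∑ j, K i j ≤ 1 / 4 := fun i =>
    (Finset.sum_le_card_nsmul _ _ ε fun j _ => hKε i j).trans (by simpa using hε)
  have hdet : (1 + K).det ≠ 0 := by
    refine det_ne_zero_of_sum_row_lt_diag fun k => ?_
    have h1 : ∑ j ∈ Finset.univ.erase k, ‖(1 + K) k j‖ = ∑ j ∈ Finset.univ.erase k, K k j := by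
      refine Finset.sum_congr rfl fun j hj => ?_
      simp [Matrix.one_apply_ne (Finset.ne_of_mem_erase hj).symm, abs_of_nonneg (hK0 k j)]
    have h2 : ∑ j ∈ Finset.univ.erase k, K k j ≤ ∑ j, K k j :=
      Finset.sum_le_sum_of_subset_of_nonneg (Finset.erase_subset _ _) fun j _ _ => hK0 k j
    have h3 : ‖(1 + K) k k‖ = 1 := by simp [hdiag]
    linarith [hrow k]
  set v := (1 + K)⁻¹ *ᵥ (1 : Fin n → ℝ)
  have hv : ∀ i, v i + ∑ j, K i j * v j = 1 := by
    have h : (1 + K) *ᵥ v = 1 := by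
      rw [Matrix.mulVec_mulVec, Matrix.mul_nonsing_inv _ (isUnit_iff_ne_zero.2 hdet),
        Matrix.one_mulVec]
    intro i
    have hi := congrFun h i
    rwa [Matrix.add_mulVec, Matrix.one_mulVec] at hi
  refine ⟨v, hv, fun i => ?_⟩
  have : Nonempty (Fin n) := ⟨i⟩
  obtain ⟨k, hk⟩ := Finite.exists_max fun j => |v j|
  have hsum : ∀ l, |∑ j, K l j * v j| ≤ 1 / 4 * |v k| := by
    intro l
    calc |∑ j, K l j * v j| ≤ ∑ j, |K l j * v j| := Finset.abs_sum_le_sum_abs _ _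
      _ ≤ ∑ j, K l j * |v k| := by
        refine Finset.sum_le_sum fun j _ => ?_
        rw [abs_mul, abs_of_nonneg (hK0 l j)]
        exact mul_le_mul_of_nonneg_left (hk j) (hK0 l j)
      _ = (∑ j, K l j) * |v k| := (Finset.sum_mul _ _ _).symm
      _ ≤ 1 / 4 * |v k| := mul_le_mul_of_nonneg_right (hrow l) (abs_nonneg _)
  -- The largest entry has absolute value at most `4 / 3`, so every entry is at least `2 / 3`.
  have hmax : |v k| ≤ 1 + 1 / 4 * |v k| := by
    have h1 : v k = 1 - ∑ j, K k j * v j := by linarith [hv k]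
    calc |v k| = |1 - ∑ j, K k j * v j| := by rw [← h1]
      _ ≤ |(1 : ℝ)| + |∑ j, K k j * v j| := abs_sub _ _
      _ ≤ 1 + 1 / 4 * |v k| := by rw [abs_one]; linarith [hsum k]
  linarith [hv i, (abs_le.1 (hsum i)).2]

/-! ### Scarf faces are hull faces -/

/-- For a strongly neighborly set there is a positive functional that equals `1` on its
exponential points and exceeds `1` on those of all other points of `A`. -/
lemma exists_supporting_functional (hn : 1 ≤ n) {A σ : Set (Fin n → ℤ)} (hgen : IsGeneric A)
    (hσ : IsStronglyNeighborly A σ) (hne : σ.Nonempty) {t : ℝ} (ht : 4 * n < t) :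
    ∃ c : Fin n → ℝ, (∀ i, 0 < c i) ∧ (∀ α ∈ σ, c ⬝ᵥ expPoint t α = 1) ∧
      ∀ β ∈ A, β ∉ σ → 1 < c ⬝ᵥ expPoint t β := by
  classical
  have hn' : (1 : ℝ) ≤ n := by exact_mod_cast hn
  have ht1 : 1 < t := by linarith
  have ht0 : 0 < t := by linarith
  obtain ⟨s, hs⟩ := exists_isLUB hσ.2.1 hne
  have hempty := hσ.openOrthant_inter_eq_empty hs
  choose p hpσ hps using (isLUB_iff_attained.1 hs).2
  have hpeq : ∀ α ∈ σ, ∀ i, α i = s i → p i = α := fun α hα i hi =>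
    hgen.eq_of_coord_eq hempty (hσ.1 (hpσ i)) (hσ.1 hα) (hs.1 (hpσ i)) (hs.1 hα) (hps i) hi
  -- The number of coordinates attained by the point that attains the coordinate `j`.
  let N : Fin n → ℝ := fun j => ((Finset.univ.filter fun k => p k = p j).card : ℝ)
  have hN1 : ∀ j, 1 ≤ N j := fun j => by
    simp only [N]
    have : 0 < (Finset.univ.filter fun k => p k = p j).card :=
      Finset.card_pos.2 ⟨j, by simp⟩
    exact_mod_cast this
  have hNn : ∀ j, N j ≤ n := fun j => by
    simp only [N]
    have : (Finset.univ.filter fun k => p k = p j).card ≤ n := by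
      simpa using Finset.card_filter_le Finset.univ fun k => p k = p j
    exact_mod_cast this
  let K : Matrix (Fin n) (Fin n) ℝ := fun i j =>
    if p j = p i then 0 else (N j)⁻¹ * t ^ (p i j - s j)
  have hK0 : ∀ i j, 0 ≤ K i j := by
    intro i j
    simp only [K]
    split_ifs
    · exact le_rfl
    · have := hN1 j
      positivity
  have hKε : ∀ i j, K i j ≤ t⁻¹ := by
    intro i j
    simp only [K]
    split_ifs with hij
    · positivity
    · have hlt : p i j < s j :=
        lt_of_le_of_ne (hs.1 (hpσ i) j) fun h => hij (hpeq _ (hpσ i) j h)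
      calc (N j)⁻¹ * t ^ (p i j - s j) ≤ 1 * t ^ (p i j - s j) :=
            mul_le_mul_of_nonneg_right (inv_le_one_of_one_le₀ (hN1 j)) (by positivity)
        _ ≤ t⁻¹ := by rw [one_mul]; exact zpow_sub_le_inv ht1 hlt
  obtain ⟨v, hv, hvpos⟩ := exists_add_mulVec_eq_one hK0 hKε
    (by rw [← div_eq_mul_inv, div_le_iff₀ ht0]; linarith) fun i => by simp [K]
  have hc : ∀ i, 0 < t ^ (-s i) * (v i / N i) := fun i => by
    have := hN1 i
    have := hvpos i
    positivity
  have hcE : ∀ (α : Fin n → ℤ) i,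
      t ^ (-s i) * (v i / N i) * expPoint t α i = v i / N i * t ^ (α i - s i) := fun α i => by
    rw [expPoint, sub_eq_add_neg, zpow_add₀ ht0.ne']
    ring
  refine ⟨fun i => t ^ (-s i) * (v i / N i), hc, fun α hα => ?_, fun β hβ hβσ => ?_⟩
  · obtain ⟨i, hi⟩ := exists_coord_eq hempty (hσ.1 hα) (hs.1 hα)
    obtain rfl := hpeq α hα i hi
    simp only [dotProduct, hcE]
    -- Rows of `K` that belong to the same point agree, and so do the entries of `v`.
    have hvij : ∀ j, p j = p i → v j = v i := by
      intro j hj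
      have h : ∀ l, K j l = K i l := fun l => by simp only [K, hj]
      have h1 := hv j
      simp only [h] at h1
      linarith [hv i]
    have hterm : ∀ j, v j / N j * t ^ (p i j - s j) =
        (if p j = p i then v i / N i else 0) + K i j * v j := by
      intro j
      by_cases hj : p j = p i
      · have h1 : p i j - s j = 0 := by rw [← hj, hps, sub_self]
        have h2 : N j = N i := by simp only [N, hj]
        simp [K, hj, h1, h2, hvij j hj]
      · simp only [K, if_neg hj]
        ring
    rw [Finset.sum_congr rfl fun j _ => hterm j, Finset.sum_add_distrib, ← Finset.sum_filter,
      Finset.sum_const, nsmul_eq_mul, ← hv i]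
    congr 1
    exact mul_div_cancel₀ (v i) (zero_lt_one.trans_le (hN1 i)).ne'
  · have hnle : ¬ β ≤ s := fun h => hβσ (hσ.mem_of_le hs hβ h)
    obtain ⟨i, hi⟩ : ∃ i, s i < β i := by
      simpa [Pi.le_def] using hnle
    have hle : t ≤ t ^ (β i - s i) := by
      calc t = t ^ (1 : ℤ) := (zpow_one t).symm
        _ ≤ t ^ (β i - s i) := zpow_le_zpow_right₀ ht1.le (by lia)
    have hlow : 1 < v i / N i * t := by
      have h1 := hN1 i
      rw [div_mul_eq_mul_div, lt_div_iff₀ (by linarith)]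
      nlinarith [hNn i, hvpos i]
    calc (1 : ℝ) < v i / N i * t := hlow
      _ ≤ v i / N i * t ^ (β i - s i) := mul_le_mul_of_nonneg_left hle <| by
        have := hN1 i
        have := hvpos i
        positivity
      _ = t ^ (-s i) * (v i / N i) * expPoint t β i := (hcE β i).symm
      _ ≤ _ := Finset.single_le_sum
        (f := fun i => t ^ (-s i) * (v i / N i) * expPoint t β i)
        (fun j _ => (mul_pos (hc j) (expPoint_pos ht0 β j)).le) (Finset.mem_univ i)

lemma isFaceOf_convexHull_empty (hn : 1 ≤ n) {t : ℝ} (ht : 0 < t) (A : Set (Fin n → ℤ)) :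
    IsFaceOf (hullPolyhedron t A) (convexHull ℝ ∅) := by
  have hpos : ∀ x ∈ hullPolyhedron t A, 0 ≤ x := by
    rintro _ ⟨x, hx, y, hy, rfl⟩
    replace hy : 0 ≤ y := hy
    have hsub : convexHull ℝ (expPoint t '' A) ⊆ Set.Ici 0 := by
      refine convexHull_min ?_ (convex_Ici (𝕜 := ℝ) 0)
      rintro _ ⟨α, -, rfl⟩ i
      exact (expPoint_pos ht α i).le
    exact add_nonneg (hsub hx) hy
  have hsum : ∀ x ∈ hullPolyhedron t A, 0 ≤ ∑ i, (1 : Fin n → ℝ) i * x i := fun x hx =>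
    Finset.sum_nonneg fun i _ => mul_nonneg zero_le_one (hpos x hx i)
  refine ⟨1, -1, fun h => one_ne_zero (congrFun h ⟨0, hn⟩), fun x hx => ?_, ?_⟩
  · linarith [hsum x hx]
  · rw [convexHull_empty, eq_comm, Set.eq_empty_iff_forall_notMem]
    rintro x ⟨hx, hx1⟩
    linarith [hsum x hx]

lemma IsStronglyNeighborly.isFaceOf (hn : 1 ≤ n) {A σ : Set (Fin n → ℤ)} (hgen : IsGeneric A)
    (hσ : IsStronglyNeighborly A σ) {t : ℝ} (ht : 4 * n < t) :
    IsFaceOf (hullPolyhedron t A) (convexHull ℝ (expPoint t '' σ)) := by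
  have hn' : (1 : ℝ) ≤ n := by exact_mod_cast hn
  have ht1 : 1 < t := by linarith
  rcases σ.eq_empty_or_nonempty with rfl | hne
  · rw [Set.image_empty]
    exact isFaceOf_convexHull_empty hn (by linarith) A
  obtain ⟨c, hc, hone, hlt⟩ := exists_supporting_functional hn hgen hσ hne ht
  have hS : ∀ x ∈ expPoint t '' σ, c ⬝ᵥ x = 1 := by
    rintro _ ⟨α, hα, rfl⟩
    exact hone α hα
  have hV : ∀ x ∈ expPoint t '' A, x ∉ expPoint t '' σ → 1 < c ⬝ᵥ x := by
    rintro _ ⟨α, hα, rfl⟩ hx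
    exact hlt α hα fun h => hx ⟨α, h, rfl⟩
  have hconv := fun x (hx : x ∈ convexHull ℝ (expPoint t '' A)) => mem_convexHull_or_lt hS hV hx
  have hge : ∀ x ∈ convexHull ℝ (expPoint t '' A), 1 ≤ c ⬝ᵥ x := fun x hx =>
    (hconv x hx).elim (fun h => h.2.ge) le_of_lt
  have hnonneg : ∀ y : Fin n → ℝ, 0 ≤ y → 0 ≤ c ⬝ᵥ y := fun y hy =>
    dotProduct_nonneg_of_nonneg (fun i => (hc i).le) hy
  refine ⟨c, 1, fun h => (hc ⟨0, hn⟩).ne' (congrFun h _), ?_, ?_⟩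
  · rintro _ ⟨x, hx, y, hy, rfl⟩
    change 1 ≤ c ⬝ᵥ (x + y)
    rw [dotProduct_add]
    linarith [hge x hx, hnonneg y hy]
  · refine Set.Subset.antisymm (fun x hx => ?_) ?_
    · have hxA := convexHull_mono (Set.image_mono hσ.1) hx
      have hx1 : c ⬝ᵥ x = 1 :=
        convexHull_min (t := {x | c ⬝ᵥ x = 1}) hS
          (convex_hyperplane (dotProductBilin ℝ ℝ c).isLinear 1) hx
      exact ⟨⟨x, hxA, 0, le_refl (0 : Fin n → ℝ), add_zero x⟩, hx1⟩
    · rintro _ ⟨⟨x, hx, y, hy, rfl⟩, hxy⟩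
      replace hxy : c ⬝ᵥ (x + y) = 1 := hxy
      rw [dotProduct_add] at hxy
      have hx1 := hge x hx
      have hy0 := hnonneg y hy
      -- Since all weights are positive, the recession part `y` vanishes.
      have hyz : y = 0 := by
        have hsum : ∑ i, c i * y i = 0 := by
          change c ⬝ᵥ y = 0
          linarith
        funext i
        have hi := (Finset.sum_eq_zero_iff_of_nonneg
          fun i _ => mul_nonneg (hc i).le (hy i)).1 hsum i (Finset.mem_univ i)
        exact (mul_eq_zero.1 hi).resolve_left (hc i).ne'
      subst hyz
      change x + 0 ∈ _
      rw [add_zero]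
      rcases hconv x hx with h | h
      · exact h.1
      · linarith

/-- The exponential points of a strongly neighborly set are linearly independent: restricted to one
private coordinate per point, they form, after scaling, a diagonally dominant matrix. -/
lemma affineIndependent_expPoint (hn : 1 ≤ n) {A σ : Set (Fin n → ℤ)} (hgen : IsGeneric A)
    (hσ : IsStronglyNeighborly A σ) {t : ℝ} (ht : 4 * n < t) :
    AffineIndependent ℝ fun α : σ => expPoint t (α : Fin n → ℤ) := by
  classical
  have hn' : (1 : ℝ) ≤ n := by exact_mod_cast hn
  have ht1 : 1 < t := by linarith
  have ht0 : 0 < t := by linarith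
  rcases σ.eq_empty_or_nonempty with rfl | hne
  · exact affineIndependent_of_subsingleton ℝ fun α : (∅ : Set (Fin n → ℤ)) =>
      expPoint t (α : Fin n → ℤ)
  obtain ⟨s, hs⟩ := exists_isLUB hσ.2.1 hne
  have hempty := hσ.openOrthant_inter_eq_empty hs
  have : Fintype σ := hσ.2.1.fintype
  choose q hq using fun α : σ => exists_coord_eq hempty (hσ.1 α.2) (hs.1 α.2)
  have heq : ∀ α β : σ, (β : Fin n → ℤ) (q α) = s (q α) → β = α := fun α β h =>
    Subtype.ext (hgen.eq_of_coord_eq hempty (hσ.1 β.2) (hσ.1 α.2) (hs.1 β.2) (hs.1 α.2) h (hq α))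
  have hcard : (Fintype.card σ : ℝ) ≤ n := by
    have hinj : Function.Injective q := fun α β h => heq β α (h ▸ hq α)
    have := Fintype.card_le_of_injective q hinj
    rw [Fintype.card_fin] at this
    exact_mod_cast this
  let M : Matrix σ σ ℝ := fun α β => t ^ ((β : Fin n → ℤ) (q α) - s (q α))
  have hdet : M.det ≠ 0 := by
    refine det_ne_zero_of_sum_row_lt_diag fun α => ?_
    have h1 : ‖M α α‖ = 1 := by simp [M, hq]
    have h2 : ∀ β ∈ Finset.univ.erase α, ‖M α β‖ ≤ t⁻¹ := by
      intro β hβ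
      have hlt : (β : Fin n → ℤ) (q α) < s (q α) :=
        lt_of_le_of_ne (hs.1 β.2 _) fun h => Finset.ne_of_mem_erase hβ (heq α β h)
      rw [Real.norm_of_nonneg (by positivity)]
      exact zpow_sub_le_inv ht1 hlt
    calc ∑ β ∈ Finset.univ.erase α, ‖M α β‖ ≤ (Finset.univ.erase α).card • t⁻¹ :=
          Finset.sum_le_card_nsmul _ _ _ h2
      _ ≤ n * t⁻¹ := by
        rw [nsmul_eq_mul]
        refine mul_le_mul_of_nonneg_right (le_trans ?_ hcard) (by positivity)
        exact_mod_cast Finset.card_le_univ _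
      _ < 1 := by rw [← div_eq_mul_inv, div_lt_one ht0]; linarith
      _ = ‖M α α‖ := h1.symm
  refine LinearIndependent.affineIndependent (k := ℝ)
    (v := fun α : σ => expPoint t (α : Fin n → ℤ)) ?_
  rw [Fintype.linearIndependent_iff]
  intro g hg
  have hMg : M *ᵥ g = 0 := by
    funext α
    have h := congrFun hg (q α)
    simp only [Finset.sum_apply, Pi.smul_apply, smul_eq_mul, Pi.zero_apply] at h
    simp only [Matrix.mulVec, dotProduct, Pi.zero_apply, M]
    calc ∑ β : σ, t ^ ((β : Fin n → ℤ) (q α) - s (q α)) * g β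
        = t ^ (-s (q α)) * ∑ β : σ, g β * expPoint t β (q α) := by
          rw [Finset.mul_sum]
          refine Finset.sum_congr rfl fun β _ => ?_
          rw [expPoint, sub_eq_add_neg, zpow_add₀ ht0.ne']
          ring
      _ = 0 := by rw [h, mul_zero]
  exact congrFun (Matrix.eq_zero_of_mulVec_eq_zero hdet hMg)

/-! ### Hull faces are Scarf faces -/

/-- If `ℓ ≥ m > 0` on the exponential points of `A`, where `ℓ` has nonnegative coefficients `c`, and
`c i * t ^ h i ≤ m` for all `i`, then no point of `A` is strictly below `h` in all the coordinates
with positive coefficient. -/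
lemma exists_le_of_le_functional {A : Set (Fin n → ℤ)} {t : ℝ} (ht : 1 < t) (hnt : n < t)
    {c : Fin n → ℝ} {m : ℝ} (hm : 0 < m) (hc : ∀ i, 0 ≤ c i)
    (hA : ∀ β ∈ A, m ≤ c ⬝ᵥ expPoint t β) {h : Fin n → ℤ}
    (hh : ∀ i, 0 < c i → c i * t ^ h i ≤ m) {γ : Fin n → ℤ} (hγ : γ ∈ A) :
    ∃ i, 0 < c i ∧ h i ≤ γ i := by
  by_contra! hlt
  have ht0 : 0 < t := by linarith
  have hterm : ∀ i, c i * expPoint t γ i ≤ m * t⁻¹ := by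
    intro i
    rcases (hc i).eq_or_lt with hi | hi
    · rw [← hi, zero_mul]
      positivity
    · calc c i * t ^ γ i = c i * t ^ h i * t ^ (γ i - h i) := by
            rw [mul_assoc, ← zpow_add₀ ht0.ne', add_sub_cancel]
        _ ≤ m * t⁻¹ :=
            mul_le_mul (hh i hi) (zpow_sub_le_inv ht (hlt i hi)) (by positivity) hm.le
  have hsum : c ⬝ᵥ expPoint t γ ≤ n * (m * t⁻¹) := by
    simpa [dotProduct] using Finset.sum_le_card_nsmul Finset.univ _ _ fun i _ => hterm i
  have hsmall : n * (m * t⁻¹) < m := by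
    rw [← mul_assoc, ← div_eq_mul_inv, div_lt_iff₀ ht0, mul_comm]
    exact mul_lt_mul_of_pos_left hnt hm
  linarith [hA γ hγ]

lemma IsGeneric.isStronglyNeighborly_of_isFaceOf (hn : 1 ≤ n) {A F : Set (Fin n → ℤ)}
    (hgen : IsGeneric A) (hFA : F ⊆ A) {t : ℝ} (ht : 4 * n < t)
    (hface : IsFaceOf (hullPolyhedron t A) (convexHull ℝ (expPoint t '' F))) :
    IsStronglyNeighborly A F := by
  classical
  have hn' : (1 : ℝ) ≤ n := by exact_mod_cast hn
  have ht1 : 1 < t := by linarith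
  have ht0 : 0 < t := by linarith
  rcases F.eq_empty_or_nonempty with rfl | ⟨α₀, hα₀⟩
  · exact isStronglyNeighborly_empty hn A
  obtain ⟨c, m, hc0, hge, heq⟩ := hface
  replace hge : ∀ x ∈ hullPolyhedron t A, m ≤ c ⬝ᵥ x := hge
  have hF : ∀ α ∈ F, c ⬝ᵥ expPoint t α = m := by
    intro α hα
    have h := subset_convexHull ℝ _ (Set.mem_image_of_mem (expPoint t) hα)
    rw [heq] at h
    exact h.2
  have hA : ∀ β ∈ A, m ≤ c ⬝ᵥ expPoint t β := by
    intro β hβ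
    have h := hge _ (expPoint_add_mem_hullPolyhedron hβ le_rfl)
    rwa [add_zero] at h
  have hray : ∀ (i : Fin n) (r : ℝ), 0 ≤ r →
      expPoint t α₀ + Pi.single i r ∈ hullPolyhedron t A := fun i r hr =>
    expPoint_add_mem_hullPolyhedron (hFA hα₀) (Pi.single_nonneg.2 hr)
  have hc : ∀ i, 0 ≤ c i := by
    intro i
    have h := hge _ (hray i 1 zero_le_one)
    rw [dotProduct_add_single, hF α₀ hα₀] at h
    linarith
  have hle : ∀ α ∈ F, ∀ i, c i * t ^ α i ≤ m := by
    intro α hα i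
    rw [← hF α hα]
    exact Finset.single_le_sum (f := fun i => c i * expPoint t α i)
      (fun j _ => mul_nonneg (hc j) (expPoint_pos ht0 α j).le) (Finset.mem_univ i)
  have hm : 0 < m := by
    obtain ⟨i, hi⟩ := Function.ne_iff.1 hc0
    exact (mul_pos ((hc i).lt_of_ne' hi) (zpow_pos ht0 (α₀ i))).trans_le (hle α₀ hα₀ i)
  have hmax : ∀ i, ∃ k : ℤ, 0 < c i → (∃ α ∈ F, α i = k) ∧ ∀ α ∈ F, α i ≤ k := by
    intro i
    by_cases hi : 0 < c i
    · obtain ⟨N, hN⟩ := pow_unbounded_of_one_lt (m / c i) ht1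
      have hbdd : ∀ k : ℤ, (∃ α ∈ F, α i = k) → k ≤ N := by
        rintro _ ⟨α, hα, rfl⟩
        have h1 : t ^ α i ≤ m / c i := by
          rw [le_div_iff₀ hi, mul_comm]
          exact hle α hα i
        refine ((zpow_lt_zpow_iff_right₀ ht1).1 (h1.trans_lt ?_)).le
        rwa [zpow_natCast]
      obtain ⟨k, hk, hk'⟩ := Int.exists_greatest_of_bdd ⟨N, hbdd⟩ ⟨_, α₀, hα₀, rfl⟩
      exact ⟨k, fun _ => ⟨hk, fun α hα => hk' _ ⟨α, hα, rfl⟩⟩⟩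
    · exact ⟨0, fun h => absurd h hi⟩
  choose h hh using hmax
  have hcoord : ∀ γ ∈ A, ∃ i, 0 < c i ∧ h i ≤ γ i := fun γ hγ =>
    exists_le_of_le_functional ht1 (by linarith) hm hc hA (fun i hi => by
      obtain ⟨α, hα, hαi⟩ := (hh i hi).1
      rw [← hαi]
      exact hle α hα i) hγ
  -- In the coordinates with zero coefficient, where `F` need not be bounded above, genericity is
  -- applied to an orthant large enough to contain the two given points.
  have huniq : ∀ α ∈ F, ∀ β ∈ F, ∀ i, 0 < c i → α i = h i → β i = h i → α = β := by
    intro α hα β hβ i hi hαi hβi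
    have hempty : openOrthant (fun j => if 0 < c j then h j else max (α j) (β j)) ∩ A = ∅ := by
      refine Set.eq_empty_iff_forall_notMem.2 fun γ ⟨hlt, hγ⟩ => ?_
      obtain ⟨j, hj, hjγ⟩ := hcoord γ hγ
      have := hlt j
      simp only [if_pos hj] at this
      exact this.not_ge hjγ
    refine hgen.eq_of_coord_eq hempty (hFA hα) (hFA hβ) (i := i) (fun j => ?_) (fun j => ?_)
      (by simpa only [if_pos hi] using hαi) (by simpa only [if_pos hi] using hβi)
    · by_cases hj : 0 < c j
      · simpa only [if_pos hj] using (hh j hj).2 α hα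
      · simp only [if_neg hj, le_max_left]
    · by_cases hj : 0 < c j
      · simpa only [if_pos hj] using (hh j hj).2 β hβ
      · simp only [if_neg hj, le_max_right]
  have hattained : ∀ α : F, ∃ i, 0 < c i ∧ (α : Fin n → ℤ) i = h i := by
    intro α
    obtain ⟨i, hi, hle'⟩ := hcoord α (hFA α.2)
    exact ⟨i, hi, le_antisymm ((hh i hi).2 α α.2) hle'⟩
  choose q hqc hq using hattained
  have hfin : F.Finite := by
    have hinj : Function.Injective q := fun α β hαβ =>
      Subtype.ext (huniq α α.2 β β.2 (q α) (hqc α) (hq α) (hαβ ▸ hq β))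
    exact Set.finite_coe_iff.1 (Finite.of_injective q hinj)
  -- A zero coefficient would make the face unbounded.
  have hcpos : ∀ i, 0 < c i := by
    intro i
    refine (hc i).lt_of_ne' fun hi => ?_
    obtain ⟨R, hR⟩ := (hfin.image fun α => expPoint t α i).bddAbove
    have hbound : convexHull ℝ (expPoint t '' F) ⊆ {x | x i ≤ R} := by
      refine convexHull_min ?_ (convex_halfSpace_le
        (LinearMap.proj (R := ℝ) (φ := fun _ : Fin n => ℝ) i).isLinear R)
      rintro _ ⟨α, hα, rfl⟩
      exact hR ⟨α, hα, rfl⟩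
    have hR0 : 0 < R := (expPoint_pos ht0 α₀ i).trans_le (hR ⟨α₀, hα₀, rfl⟩)
    have hmem : expPoint t α₀ + Pi.single i R ∈ convexHull ℝ (expPoint t '' F) := by
      rw [heq]
      refine ⟨hray i R hR0.le, ?_⟩
      change c ⬝ᵥ _ = m
      rw [dotProduct_add_single, hi, zero_mul, add_zero, hF α₀ hα₀]
    have hcontra : expPoint t α₀ i + R ≤ R := by simpa using hbound hmem
    linarith [expPoint_pos ht0 α₀ i]
  have hlub : IsLUB F h := isLUB_iff_attained.2
    ⟨fun α hα i => (hh i (hcpos i)).2 α hα, fun i => (hh i (hcpos i)).1⟩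
  refine hgen.isStronglyNeighborly hFA hfin hlub (Set.eq_empty_iff_forall_notMem.2 ?_)
  rintro γ ⟨hlt, hγ⟩
  obtain ⟨i, -, hi⟩ := hcoord γ hγ
  exact (hlt i).not_ge hi

/-! ### The isomorphism -/

lemma mem_hullComplex_iff (hn : 1 ≤ n) {A : Set (Fin n → ℤ)} (hgen : IsGeneric A) {t : ℝ}
    (ht : 4 * n < t) (G : Set (Fin n → ℝ)) :
    G ∈ hullComplex t A ↔ ∃ σ ∈ scarfComplex A, expPoint t '' σ = G := by
  constructor
  · rintro ⟨F, hFA, rfl, hface⟩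
    exact ⟨F, hgen.isStronglyNeighborly_of_isFaceOf hn hFA ht hface, rfl⟩
  · rintro ⟨σ, hσ, rfl⟩
    exact ⟨σ, hσ.1, rfl, IsStronglyNeighborly.isFaceOf hn hgen hσ ht⟩

end ScarfHull

theorem mainTheorem2 (n : ℕ) (hn : 1 ≤ n) (Λ : AddSubgroup (Fin n → ℤ))
    (hΛ : IsAntichain (· ≤ ·) (Λ : Set (Fin n → ℤ)))
    (A : Set (Fin n → ℤ)) (hA : ScarfHull.IsLambdaFinite Λ A) (hgen : ScarfHull.IsGeneric A) :
    ∃ T : ℝ, 1 < T ∧ ∀ t : ℝ, T ≤ t →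
      ScarfHull.IsComplexIso (ScarfHull.scarfComplex A) (ScarfHull.hullComplex t A)
        (ScarfHull.expPoint t) ∧
      ∀ σ ∈ ScarfHull.scarfComplex A,
        AffineIndependent ℝ (fun α : σ => ScarfHull.expPoint t (α : Fin n → ℤ)) := by
  have hn' : (1 : ℝ) ≤ n := by exact_mod_cast hn
  refine ⟨4 * n + 1, by linarith, fun t ht => ?_⟩
  replace ht : 4 * n < t := by linarith
  have hinj := ScarfHull.expPoint_injective (n := n) (t := t) (by linarith)
  have hiff := ScarfHull.mem_hullComplex_iff hn hgen ht
  refine ⟨⟨⟨?_, hinj.injOn, ?_⟩, fun σ _ => ?_⟩,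
    fun σ hσ => ScarfHull.affineIndependent_expPoint hn hgen hσ ht⟩
  · rintro α ⟨σ, hσ, hα⟩
    exact ⟨_, (hiff _).2 ⟨σ, hσ, rfl⟩, α, hα, rfl⟩
  · rintro x ⟨G, hG, hx⟩
    obtain ⟨σ, hσ, rfl⟩ := (hiff G).1 hG
    obtain ⟨α, hα, rfl⟩ := hx
    exact ⟨α, ⟨σ, hσ, hα⟩, rfl⟩
  · refine ⟨fun hσ => (hiff _).2 ⟨σ, hσ, rfl⟩, fun hσ => ?_⟩
    obtain ⟨F, hF, hFσ⟩ := (hiff _).1 hσ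
    exact hinj.image_injective hFσ ▸ hF
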